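/- Let $n \ge 0$, let $r>0$, and let $X\subseteq\mathbb{R}^n$ be a nonempty (possibly unbounded) set. The erosion of $X$ by the radius $r$ is $$e_r(X)=X\setminus\bigcup_{y\in \mathbb{R}^n\setminus X}B(r,y),$$ where $B(r,y)$ is the open ball of radius $r$ about $y$. A distance-decreasing similarity transformation is a bijection $\sigma:\mathbb{R}^n\to\mathbb{R}^n$ for which there is a scaling factor $0<\alpha<1$ with $|\sigma(x)-\sigma(y)|=\alpha|x-y|$ for all $x,y$. A convex body is a closed convex subset of $\mathbb{R}^n$ (not necessarily bounded). A closed half-space $H\supseteq X$ is a supporting half-space of $X$ at a boundary point $x$ of $X$ if $x$ also lies on the boundary of $H$; the boundary point $x$ is regular if $X$ has exactly one supporting half-space at $x$; a regular supporting hyperplane of $X$ is the boundary of a half-space that supports $X$ at some regular point. A closed ball $B$ is inscribed in a convex body $X$ if $B\subseteq X$ and $B$ meets every regular supporting hyperplane of $X$. Then there is a distance-decreasing similarity transformation $\sigma$ of $\mathbb{R}^n$ with $\sigma(X)=e_r(X)$ if and only if $X$ is a convex body that has an inscribed ball of radius greater than $r$. -/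

import Mathlib

namespace Resilient

/-- The erosion of `X` by the radius `r`: the set `X` with all open balls of radius `r` about points
of the complement of `X` removed. -/
def erosion {n : ℕ} (r : ℝ) (X : Set (EuclideanSpace ℝ (Fin n))) :
    Set (EuclideanSpace ℝ (Fin n)) :=
  X \ ⋃ y ∈ Xᶜ, Metric.ball y r

/-- A similarity transformation (a bijective dilation) is distance-decreasing if it multiplies all
distances by one scaling factor `α` with `0 < α < 1`. The factor is given explicitly because
`Dilation.ratio` is `1` by convention on a one-point space. -/
def IsDistanceDecreasing {n : ℕ}
    (σ : EuclideanSpace ℝ (Fin n) ≃ᵈ EuclideanSpace ℝ (Fin n)) : Prop :=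
  ∃ α : ℝ, 0 < α ∧ α < 1 ∧ ∀ x y, dist (σ x) (σ y) = α * dist x y

/-- A convex body is a closed convex set; it need not be bounded. -/
def IsConvexBody {n : ℕ} (X : Set (EuclideanSpace ℝ (Fin n))) : Prop :=
  IsClosed X ∧ Convex ℝ X

/-- A closed half-space. -/
def IsClosedHalfSpace {n : ℕ} (H : Set (EuclideanSpace ℝ (Fin n))) : Prop :=
  ∃ (u : EuclideanSpace ℝ (Fin n)) (b : ℝ), u ≠ 0 ∧ H = {y | inner ℝ u y ≤ b}

/-- `H` is a supporting half-space of `X` at the boundary point `x` of `X`. -/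
def IsSupportingHalfSpaceAt {n : ℕ} (X H : Set (EuclideanSpace ℝ (Fin n)))
    (x : EuclideanSpace ℝ (Fin n)) : Prop :=
  IsClosedHalfSpace H ∧ X ⊆ H ∧ x ∈ frontier X ∧ x ∈ frontier H

/-- A boundary point of `X` is regular if `X` has a unique supporting half-space at it. -/
def IsRegularPoint {n : ℕ} (X : Set (EuclideanSpace ℝ (Fin n)))
    (x : EuclideanSpace ℝ (Fin n)) : Prop :=
  x ∈ frontier X ∧ ∃! H : Set (EuclideanSpace ℝ (Fin n)), IsSupportingHalfSpaceAt X H x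

/-- A supporting half-space of `X` is regular if it supports `X` at some regular point. -/
def IsRegularSupportingHalfSpace {n : ℕ} (X H : Set (EuclideanSpace ℝ (Fin n))) : Prop :=
  ∃ x, IsRegularPoint X x ∧ IsSupportingHalfSpaceAt X H x

/-- A regular supporting hyperplane is the boundary of a regular supporting half-space. -/
def IsRegularSupportingHyperplane {n : ℕ} (X P : Set (EuclideanSpace ℝ (Fin n))) : Prop :=
  ∃ H, IsRegularSupportingHalfSpace X H ∧ P = frontier H

/-- The closed ball with centre `c` and radius `R` is inscribed in `X`: it is contained in `X` and
meets every regular supporting hyperplane of `X`. -/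
def IsInscribedBall {n : ℕ} (X : Set (EuclideanSpace ℝ (Fin n)))
    (c : EuclideanSpace ℝ (Fin n)) (R : ℝ) : Prop :=
  Metric.closedBall c R ⊆ X ∧
    ∀ P, IsRegularSupportingHyperplane X P → (Metric.closedBall c R ∩ P).Nonempty

end Resilient

/-! Put R = r/(1-α), so that α = 1 - r/R. If a ball of radius R > r about c is inscribed in X, the
homothety of ratio α about c works. Convexity gives αX + (1-α)B(c,R) ⊆ X, hence one inclusion. For
the other, regular supporting half-spaces suffice to cut out X (`exists_regular_separation`), each
has its boundary at distance R from c, and points of the erosion stay at distance r from that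
boundary.

Conversely, σ has a fixed point c, and the erosion relation iterates: x ∈ X iff the ball of radius
R(1-α^k) about σ^k x lies in X, for k ≥ 1. Letting k grow puts the closed R-ball about c inside X.
Pulled back by σ^k, the same relation covers the complement by arbitrarily large balls missing X,
which forces convexity (`convex_of_large_balls`). Finally write σ x = c + αA(x-c) with A a linear
isometry. A regular supporting hyperplane with normal u at distance R + d from c yields one with
normal Au at distance R + αd. Since A is recurrent, some A^k u returns close to u with too small an
excess unless d ≤ 0 (`inner_le_of_regular`). -/

namespace Resilient

open Metric

/-! ### Unit normals, touching balls and regular separation -/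

section ConvexGeometry

variable {E : Type*} [NormedAddCommGroup E] [InnerProductSpace ℝ E]

/-- `u` is a unit outer normal of `X` at `x`. -/
def IsUnitNormal (X : Set E) (x u : E) : Prop :=
  ‖u‖ = 1 ∧ ∀ y ∈ X, inner ℝ u y ≤ inner ℝ u x

theorem inner_add_le_of_ball_subset {m v : E} {ρ b : ℝ} (hρ : 0 < ρ) (hv : ‖v‖ = 1)
    (h : ∀ y ∈ ball m ρ, inner ℝ v y ≤ b) : inner ℝ v m + ρ ≤ b := by
  by_contra! hlt
  have h0 := h m (mem_ball_self hρ)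
  have hs0 : 0 ≤ (b - inner ℝ v m + ρ) / 2 := by linarith
  -- The shift lies strictly between `b - inner ℝ v m` and `ρ`: still inside the ball, already past
  -- the hyperplane.
  have h1 := h (m + ((b - inner ℝ v m + ρ) / 2) • v) (by
    rw [mem_ball, dist_eq_norm, add_sub_cancel_left, norm_smul, hv, Real.norm_of_nonneg hs0]
    linarith)
  rw [inner_add_right, inner_smul_right, real_inner_self_eq_norm_sq, hv] at h1
  linarith

theorem eq_of_one_le_inner {u v : E} (hu : ‖u‖ = 1) (hv : ‖v‖ = 1) (h : 1 ≤ inner ℝ u v) :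
    u = v := by
  rw [← inner_eq_one_iff_of_norm_eq_one (𝕜 := ℝ) hu hv]
  refine le_antisymm ?_ h
  simpa [hu, hv] using real_inner_le_norm u v

theorem eq_of_halfSpace_eq {u v x : E} (hu : ‖u‖ = 1) (hv : ‖v‖ = 1)
    (h : {y | inner ℝ u y ≤ inner ℝ u x} ⊆ {y | inner ℝ v y ≤ inner ℝ v x}) : u = v := by
  have hle : inner ℝ u v ≤ 1 := by simpa [hu, hv] using real_inner_le_norm u v
  have h1 : x + (v - u) ∈ {y | inner ℝ v y ≤ inner ℝ v x} := h (by
    simp only [Set.mem_ofPred_eq, inner_add_right, inner_sub_right, real_inner_self_eq_norm_sq, hu]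
    linarith)
  simp only [Set.mem_ofPred_eq, inner_add_right, inner_sub_right, real_inner_self_eq_norm_sq, hv,
    real_inner_comm u v] at h1
  exact eq_of_one_le_inner hu hv (by linarith)

variable [CompleteSpace E]

theorem frontier_halfSpace {u : E} (hu : u ≠ 0) (b : ℝ) :
    frontier {y : E | inner ℝ u y ≤ b} = {y | inner ℝ u y = b} := by
  have hsurj : Function.Surjective (innerSL ℝ u) := by
    intro t
    refine ⟨(t / ‖u‖ ^ 2) • u, ?_⟩
    have : ‖u‖ ^ 2 ≠ 0 := by simpa using hu
    simp
    field_simp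
  have h := ContinuousLinearMap.frontier_preimage (innerSL ℝ u) hsurj (Set.Iic b)
  rw [frontier_Iic] at h
  exact h

theorem exists_isUnitNormal {X : Set E} (hX : Convex ℝ X) (hne : (interior X).Nonempty) {q : E}
    (hq : q ∉ interior X) : ∃ u, IsUnitNormal X q u := by
  obtain ⟨f, hf⟩ := geometric_hahn_banach_open_point hX.interior isOpen_interior hq
  set w := (InnerProductSpace.toDual ℝ E).symm f with hw
  have hwf : ∀ y, inner ℝ w y = f y := fun y => InnerProductSpace.toDual_symm_apply
  have hle : ∀ y ∈ X, inner ℝ w y ≤ inner ℝ w q := by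
    intro y hy
    have hcl : y ∈ closure (interior X) := by
      rw [hX.closure_interior_eq_closure_of_nonempty_interior hne]
      exact subset_closure hy
    have hcls : IsClosed {y | inner ℝ w y ≤ inner ℝ w q} :=
      isClosed_le (by fun_prop) continuous_const
    exact closure_minimal (fun a ha => by simpa [hwf] using (hf a ha).le) hcls hcl
  have hw0 : w ≠ 0 := by
    intro h0
    obtain ⟨a, ha⟩ := hne
    have := hf a ha
    rw [← hwf, ← hwf, h0] at this
    simp at this
  refine ⟨‖w‖⁻¹ • w, ?_, fun y hy => ?_⟩
  · exact norm_smul_inv_norm (𝕜 := ℝ) hw0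
  · rw [real_inner_smul_left, real_inner_smul_left]
    exact mul_le_mul_of_nonneg_left (hle y hy) (by positivity)

/-- A largest ball about `m` inside a closed convex set touches the boundary at a point with exactly
one unit normal. -/
theorem exists_touching_point [ProperSpace E] {X : Set E} (hcl : IsClosed X) (hX : Convex ℝ X)
    (hne : Xᶜ.Nonempty) {m : E} {ρ : ℝ} (hρ : 0 < ρ) (hm : infDist m Xᶜ = ρ) :
    ∃ v : E, m + ρ • v ∈ frontier X ∧ ∀ u, IsUnitNormal X (m + ρ • v) u ↔ u = v := by
  obtain ⟨q, hq, hdist⟩ := isClosed_closure.exists_infDist_eq_dist hne.closure m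
  rw [infDist_closure, hm] at hdist
  have hball : ball m ρ ⊆ X := hm ▸ ball_infDist_compl_subset
  have hqX : q ∈ X := by
    have : q ∈ closure (ball m ρ) := by
      rw [closure_ball m hρ.ne', mem_closedBall, dist_comm]
      exact hdist.ge
    exact closure_minimal hball hcl this
  have hqv : m + ρ • (ρ⁻¹ • (q - m)) = q := by
    rw [smul_inv_smul₀ hρ.ne', add_sub_cancel]
  have hv : ‖ρ⁻¹ • (q - m)‖ = 1 := by
    rw [norm_smul, ← dist_eq_norm, dist_comm, ← hdist, norm_inv, Real.norm_of_nonneg hρ.le,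
      inv_mul_cancel₀ hρ.ne']
  have huniq : ∀ u, IsUnitNormal X q u → u = ρ⁻¹ • (q - m) := by
    intro u hu
    have h := inner_add_le_of_ball_subset hρ hu.1 fun y hy => hu.2 y (hball hy)
    refine eq_of_one_le_inner hu.1 hv ?_
    rw [inner_smul_right, inner_sub_right, ← div_eq_inv_mul, le_div_iff₀ hρ]
    linarith
  refine ⟨ρ⁻¹ • (q - m), ?_, fun u => ?_⟩
  · rw [hqv, frontier_eq_closure_inter_closure]
    exact ⟨subset_closure hqX, hq⟩
  · rw [hqv]
    refine ⟨huniq u, ?_⟩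
    rintro rfl
    have hint : (interior X).Nonempty :=
      ⟨m, interior_mono hball (by rw [isOpen_ball.interior_eq]; exact mem_ball_self hρ)⟩
    obtain ⟨u, hu⟩ := exists_isUnitNormal hX hint (q := q) (by rwa [closure_compl] at hq)
    exact huniq u hu ▸ hu

/-- A point outside a closed convex set with interior points is strictly separated from it by a
supporting hyperplane at a boundary point with exactly one unit normal. -/
theorem exists_regular_separation [ProperSpace E] {X : Set E} (hcl : IsClosed X)
    (hX : Convex ℝ X) {c z : E} {R : ℝ} (hR : 0 < R) (hc : closedBall c R ⊆ X) (hz : z ∉ X) :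
    ∃ q v : E, q ∈ frontier X ∧ (∀ u, IsUnitNormal X q u ↔ u = v) ∧
      inner ℝ v q < inner ℝ v z := by
  obtain ⟨δ, hδ, hδz⟩ := Metric.isOpen_iff.1 hcl.isOpen_compl z hz
  have hcX : c ∈ X := hc (mem_closedBall_self hR.le)
  have hcz : δ ≤ ‖z - c‖ := by
    by_contra! hlt
    exact hδz (by rwa [mem_ball, dist_comm, dist_eq_norm]) hcX
  have hcz0 : 0 < ‖z - c‖ := hδ.trans_le hcz
  set η := δ / ‖z - c‖ with hη
  have hη0 : 0 < η := by positivity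
  have hη1 : η ≤ 1 := (div_le_one hcz0).2 hcz
  -- Going from `c` towards `z`, stop at the point `m` where the distance to the complement is `ε`.
  -- The hyperplane touching there is passed by `z` because `(1 - t) * s ≥ η * (R - ε) ≥ 2 * ε > ε`,
  -- where `s` is the inner product of `v` with `z - c`.
  set ε := η * R / 3 with hε
  have hε0 : 0 < ε := by positivity
  have hεR : ε < R := by nlinarith
  have hcinf : R ≤ infDist c Xᶜ := by
    refine (le_infDist ⟨z, hz⟩).2 fun y hy => ?_
    by_contra! hlt
    exact hy (hc (by rw [mem_closedBall, dist_comm]; exact hlt.le))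
  have hcont : ContinuousOn (fun t : ℝ => infDist (c + t • (z - c)) Xᶜ) (Set.Icc 0 1) :=
    ((continuous_infDist_pt _).comp (by fun_prop)).continuousOn
  obtain ⟨t, ⟨ht0, ht1⟩, ht⟩ := intermediate_value_Icc' zero_le_one hcont (show ε ∈ _ by
    constructor
    · have : infDist z Xᶜ = 0 := infDist_zero_of_mem hz
      simpa [this] using hε0.le
    · simpa using hεR.le.trans hcinf)
  dsimp only at ht
  obtain ⟨v, hfr, hv⟩ := exists_touching_point hcl hX ⟨z, hz⟩ hε0 ht
  set m := c + t • (z - c) with hm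
  have hvn := (hv v).2 rfl
  have hmX : m ∈ X := ball_infDist_compl_subset (mem_ball_self (by rw [ht]; exact hε0))
  have hzm : η ≤ 1 - t := by
    have h1 : δ ≤ ‖z - m‖ := by
      by_contra! hlt
      exact hδz (by rwa [mem_ball, dist_comm, dist_eq_norm]) hmX
    have h2 : z - m = (1 - t) • (z - c) := by rw [hm]; module
    rw [h2, norm_smul, Real.norm_of_nonneg (by linarith)] at h1
    rwa [hη, div_le_iff₀ hcz0]
  have hineq := inner_add_le_of_ball_subset hR hvn.1
    fun y hy => hvn.2 y (hc (ball_subset_closedBall hy))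
  have hq : inner ℝ v (m + ε • v) = inner ℝ v c + t * inner ℝ v (z - c) + ε := by
    rw [hm, inner_add_right, inner_add_right, inner_smul_right, inner_smul_right,
      real_inner_self_eq_norm_sq, hvn.1]
    ring
  refine ⟨_, v, hfr, hv, ?_⟩
  have hzc : inner ℝ v z = inner ℝ v c + inner ℝ v (z - c) := by
    rw [← inner_add_right, add_sub_cancel]
  rw [hq] at hineq ⊢
  rw [hzc]
  set s : ℝ := inner ℝ v (z - c)
  have hs : R - ε ≤ s := by
    have : R - ε ≤ t * s := by linarith
    have : 0 < t * s := by linarith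
    have : 0 < s := pos_of_mul_pos_right this ht0
    nlinarith
  have h3 : η * (R - ε) ≤ (1 - t) * s := by gcongr
  have h4 : η * ε ≤ ε := by nlinarith
  have h5 : η * R = 3 * ε := by rw [hε]; ring
  nlinarith

end ConvexGeometry

/-! ### Regular points and hyperplanes in terms of unit normals -/

section HalfSpaces

variable {n : ℕ} {X H : Set (EuclideanSpace ℝ (Fin n))} {x : EuclideanSpace ℝ (Fin n)}

theorem isSupportingHalfSpaceAt_iff :
    IsSupportingHalfSpaceAt X H x ↔
      x ∈ frontier X ∧ ∃ u, IsUnitNormal X x u ∧ H = {y | inner ℝ u y ≤ inner ℝ u x} := by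
  constructor
  · rintro ⟨⟨u, b, hu, rfl⟩, hXH, hx, hxH⟩
    rw [frontier_halfSpace hu] at hxH
    obtain rfl : inner ℝ u x = b := hxH
    have hpos : 0 < ‖u‖⁻¹ := by simpa using hu
    refine ⟨hx, ‖u‖⁻¹ • u, ⟨norm_smul_inv_norm (𝕜 := ℝ) hu, fun y hy => ?_⟩, ?_⟩
    · rw [real_inner_smul_left, real_inner_smul_left]
      exact mul_le_mul_of_nonneg_left (hXH hy) hpos.le
    · ext y
      simp only [Set.mem_ofPred_eq, real_inner_smul_left, mul_le_mul_iff_right₀ hpos]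
  · rintro ⟨hx, u, hu, rfl⟩
    have hu0 : u ≠ 0 := by rintro rfl; simpa using hu.1
    exact ⟨⟨u, _, hu0, rfl⟩, hu.2, hx, by rw [frontier_halfSpace hu0]; rfl⟩

theorem isRegularPoint_iff :
    IsRegularPoint X x ↔ x ∈ frontier X ∧ ∃ v, ∀ u, IsUnitNormal X x u ↔ u = v := by
  refine and_congr_right fun hx => ?_
  simp only [isSupportingHalfSpaceAt_iff, hx, true_and]
  constructor
  · rintro ⟨H, ⟨v, hv, rfl⟩, huniq⟩
    refine ⟨v, fun u => ⟨fun hu => ?_, fun h => h ▸ hv⟩⟩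
    exact eq_of_halfSpace_eq hu.1 hv.1 (huniq _ ⟨u, hu, rfl⟩).subset
  · rintro ⟨v, hv⟩
    refine ⟨_, ⟨v, (hv v).2 rfl, rfl⟩, ?_⟩
    rintro H ⟨u, hu, rfl⟩
    rw [(hv u).1 hu]

theorem isRegularSupportingHyperplane_iff {P : Set (EuclideanSpace ℝ (Fin n))} :
    IsRegularSupportingHyperplane X P ↔
      ∃ x ∈ frontier X, ∃ v, (∀ u, IsUnitNormal X x u ↔ u = v) ∧
        P = {y | inner ℝ v y = inner ℝ v x} := by
  constructor
  · rintro ⟨H, ⟨x, hreg, hsup⟩, rfl⟩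
    obtain ⟨hx, v, hv⟩ := isRegularPoint_iff.1 hreg
    obtain ⟨-, u, hu, rfl⟩ := isSupportingHalfSpaceAt_iff.1 hsup
    obtain rfl := (hv u).1 hu
    have hu0 : u ≠ 0 := by rintro rfl; simpa using hu.1
    exact ⟨x, hx, u, hv, frontier_halfSpace hu0 _⟩
  · rintro ⟨x, hx, v, hv, rfl⟩
    have hvn := (hv v).2 rfl
    have hv0 : v ≠ 0 := by rintro rfl; simpa using hvn.1
    exact ⟨_, ⟨x, isRegularPoint_iff.2 ⟨hx, v, hv⟩,
      isSupportingHalfSpaceAt_iff.2 ⟨hx, v, hvn, rfl⟩⟩, (frontier_halfSpace hv0 _).symm⟩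

end HalfSpaces

/-! ### Erosion, and the homothety about an inscribed ball -/

section Erosion

variable {n : ℕ} {X : Set (EuclideanSpace ℝ (Fin n))} {r : ℝ}

theorem erosion_eq_compl (hr : 0 < r) : erosion r X = (⋃ y ∈ Xᶜ, ball y r)ᶜ := by
  rw [erosion, Set.sdiff_eq]
  refine Set.inter_eq_right.2 fun x hx => ?_
  by_contra hxX
  exact hx (Set.mem_biUnion hxX (mem_ball_self hr))

theorem isClosed_erosion (hr : 0 < r) : IsClosed (erosion r X) := by
  rw [erosion_eq_compl hr, isClosed_compl_iff]
  exact isOpen_biUnion fun _ _ => isOpen_ball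

theorem mem_erosion_iff (hr : 0 < r) {x : EuclideanSpace ℝ (Fin n)} :
    x ∈ erosion r X ↔ ball x r ⊆ X := by
  rw [erosion_eq_compl hr]
  simp only [Set.mem_compl_iff, Set.mem_iUnion, not_exists]
  constructor
  · intro h y hy
    by_contra hyX
    exact h y hyX (mem_ball'.1 hy)
  · exact fun h y hy hxy => hy (h (mem_ball'.1 hxy))

/-- If a ball of radius `R` is inscribed in `X`, the homothety with the same centre and ratio
`1 - r / R` maps `X` onto its erosion. -/
theorem exists_similarity_of_isInscribedBall (hr : 0 < r) (hX : IsConvexBody X)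
    {c : EuclideanSpace ℝ (Fin n)} {R : ℝ} (hrR : r < R) (hc : IsInscribedBall X c R) :
    ∃ σ : EuclideanSpace ℝ (Fin n) ≃ᵈ EuclideanSpace ℝ (Fin n),
      IsDistanceDecreasing σ ∧ σ '' X = erosion r X := by
  have hR : 0 < R := hr.trans hrR
  set α := 1 - r / R with hα
  have hrR0 : 0 < r / R := div_pos hr hR
  have hα0 : 0 < α := sub_pos.2 ((div_lt_one hR).2 hrR)
  have hα1 : α < 1 := by linarith
  let e : EuclideanSpace ℝ (Fin n) ≃ EuclideanSpace ℝ (Fin n) :=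
    { toFun := fun x => c + α • (x - c)
      invFun := fun x => c + α⁻¹ • (x - c)
      left_inv := fun x => by simp [smul_smul, inv_mul_cancel₀ hα0.ne']
      right_inv := fun x => by simp [smul_smul, mul_inv_cancel₀ hα0.ne'] }
  have hdist : ∀ x y, dist (e x) (e y) = α * dist x y := fun x y => by
    simp [e, dist_smul₀, abs_of_pos hα0]
  refine ⟨⟨e, α.toNNReal, by simpa using hα0, fun x y => ?_⟩, ⟨α, hα0, hα1, hdist⟩, ?_⟩
  · rw [edist_dist, edist_dist]
    exact (congrArg ENNReal.ofReal (hdist x y)).trans (ENNReal.ofReal_mul hα0.le)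
  have himage : e '' X = erosion r X := by
    refine Set.Subset.antisymm ?_ fun x hx => ?_
    · rintro _ ⟨w, hw, rfl⟩
      rw [mem_erosion_iff hr]
      intro y hy
      -- Blowing up the offset `y - e w` from radius `r` to `R` exhibits `y` as a convex combination
      -- of `w` and a point of the inscribed ball.
      have hy' : c + (R / r) • (y - e w) ∈ X := hc.1 (by
        rw [mem_closedBall, dist_self_add_left, norm_smul, Real.norm_of_nonneg (by positivity),
          ← dist_eq_norm, div_mul_eq_mul_div, div_le_iff₀ hr]
        exact mul_le_mul_of_nonneg_left (mem_ball.1 hy).le hR.le)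
      have := hX.2 hw hy' hα0.le hrR0.le (by ring)
      convert this using 1
      rw [smul_add, smul_smul, show r / R * (R / r) = 1 by field_simp, one_smul,
        show r / R = 1 - α by ring]
      change y = α • w + ((1 - α) • c + (y - (c + α • (w - c))))
      module
    · rw [mem_erosion_iff hr] at hx
      refine ⟨e.symm x, ?_, e.apply_symm_apply x⟩
      by_contra hw
      -- The separating hyperplane is at distance `R` from `c` and at least `r` from `x`, so the
      -- preimage of `x`, with offset from `c` larger by the factor `1 / α = R / (R - r)`, cannot
      -- lie beyond it.
      obtain ⟨q, v, hq, hv, hlt⟩ := exists_regular_separation hX.1 hX.2 hR hc.1 hw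
      have hvn := (hv v).2 rfl
      obtain ⟨p, hpc, hp⟩ := hc.2 _ (isRegularSupportingHyperplane_iff.2 ⟨q, hq, v, hv, rfl⟩)
      have hle : inner ℝ v q ≤ inner ℝ v c + R := by
        have h1 : inner ℝ v q = inner ℝ v c + inner ℝ v (p - c) := by
          rw [← inner_add_right, add_sub_cancel]
          exact hp.symm
        have h2 := real_inner_le_norm v (p - c)
        rw [hvn.1, one_mul, ← dist_eq_norm] at h2
        linarith [mem_closedBall.1 hpc]
      have h1 := inner_add_le_of_ball_subset hr hvn.1 fun y hy => hvn.2 y (hx hy)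
      have h2 := inner_add_le_of_ball_subset hR hvn.1
        fun y hy => hvn.2 y (hc.1 (ball_subset_closedBall hy))
      have h3 : inner ℝ v x = inner ℝ v c + α * (inner ℝ v (e.symm x) - inner ℝ v c) := by
        conv_lhs => rw [← e.apply_symm_apply x]
        change inner ℝ v (c + α • (e.symm x - c)) = _
        rw [inner_add_right, inner_smul_right, inner_sub_right]
      have h4 : α * R = R - r := by rw [hα]; field_simp
      nlinarith
  exact himage

end Erosion

/-! ### Iterating the erosion relation -/

section Similarity

variable {n : ℕ} {X : Set (EuclideanSpace ℝ (Fin n))} {r α : ℝ}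
  {σ : EuclideanSpace ℝ (Fin n) ≃ EuclideanSpace ℝ (Fin n)}

theorem dist_iterate (hσ : ∀ x y, dist (σ x) (σ y) = α * dist x y) (k : ℕ)
    (x y : EuclideanSpace ℝ (Fin n)) : dist (σ^[k] x) (σ^[k] y) = α ^ k * dist x y := by
  induction k with
  | zero => simp
  | succ k ih => rw [Function.iterate_succ_apply', Function.iterate_succ_apply', hσ, ih]; ring

theorem mem_iff_ball_subset (hr : 0 < r) (himage : σ '' X = erosion r X)
    (x : EuclideanSpace ℝ (Fin n)) : x ∈ X ↔ ball (σ x) r ⊆ X := by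
  rw [← mem_erosion_iff hr, ← himage, σ.injective.mem_set_image]

/-- If `σ '' X` is the erosion of `X`, the images of `X` under iterates of `σ` are erosions too. -/
theorem mem_iff_ball_iterate_subset (hr : 0 < r) (hα0 : 0 < α) (hα1 : α < 1)
    (hσ : ∀ x y, dist (σ x) (σ y) = α * dist x y) (himage : σ '' X = erosion r X) (k : ℕ)
    (x : EuclideanSpace ℝ (Fin n)) :
    x ∈ X ↔ ball (σ^[k + 1] x) (r / (1 - α) * (1 - α ^ (k + 1))) ⊆ X := by
  have h1α : 0 < 1 - α := sub_pos.2 hα1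
  induction k generalizing x with
  | zero =>
    rw [mem_iff_ball_subset hr himage]
    simp [div_mul_cancel₀ _ h1α.ne']
  | succ k ih =>
    have hpos : 0 < r / (1 - α) * (1 - α ^ (k + 1)) :=
      mul_pos (div_pos hr h1α) (sub_pos.2 (pow_lt_one₀ hα0.le hα1 k.succ_ne_zero))
    have hpow : 0 < α ^ (k + 1) := pow_pos hα0 _
    -- The radii are the geometric sums r(1 + α + ... + α^k); the new term is the radius `r` scaled
    -- by `σ^[k + 1]`.
    have hsum : r / (1 - α) * (1 - α ^ (k + 1 + 1)) =
        r / (1 - α) * (1 - α ^ (k + 1)) + α ^ (k + 1) * r := by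
      field_simp
      ring
    rw [mem_iff_ball_subset hr himage, hsum, ← _root_.thickening_ball hpos (by positivity),
      thickening_eq_biUnion_ball]
    simp only [Set.iUnion_subset_iff]
    constructor
    · intro h y hy
      obtain ⟨w, rfl⟩ := σ.surjective.iterate (k + 1) y
      refine (ih w).1 (h ?_)
      rw [Function.iterate_succ_apply, mem_ball, dist_iterate hσ, mul_lt_mul_iff_right₀ hpow] at hy
      exact hy
    · intro h y hy
      refine (ih y).2 (h _ ?_)
      rw [Function.iterate_succ_apply, mem_ball, dist_iterate hσ, mul_lt_mul_iff_right₀ hpow]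
      exact hy

theorem isClosed_of_image_eq_erosion (hr : 0 < r)
    (hσ : ∀ x y, dist (σ x) (σ y) = α * dist x y) (himage : σ '' X = erosion r X) :
    IsClosed X := by
  have hcont : Continuous σ :=
    (LipschitzWith.of_dist_le_mul (K := α.toNNReal) fun x y => by
      rw [hσ]; exact mul_le_mul_of_nonneg_right (Real.le_coe_toNNReal α) dist_nonneg).continuous
  rw [← Set.preimage_image_eq X σ.injective, himage]
  exact (isClosed_erosion hr).preimage hcont

-- For any `x` in `X`, the iterates of `x` tend to `c` and the radii of their balls in `X` tend to
-- `r / (1 - α)`.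
open Filter Topology in
theorem closedBall_subset_of_image_eq_erosion (hr : 0 < r) (hα0 : 0 < α) (hα1 : α < 1)
    (hσ : ∀ x y, dist (σ x) (σ y) = α * dist x y) (himage : σ '' X = erosion r X)
    (hne : X.Nonempty) {c : EuclideanSpace ℝ (Fin n)} (hc : σ c = c) :
    closedBall c (r / (1 - α)) ⊆ X := by
  have hR : 0 < r / (1 - α) := div_pos hr (sub_pos.2 hα1)
  rw [← closure_ball c hR.ne']
  refine closure_minimal (fun y hy => ?_) (isClosed_of_image_eq_erosion hr hσ himage)
  obtain ⟨x, hx⟩ := hne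
  have hpow : Tendsto (fun k : ℕ => α ^ (k + 1)) atTop (𝓝 0) :=
    (tendsto_pow_atTop_nhds_zero_of_lt_one hα0.le hα1).comp (tendsto_add_atTop_nat 1)
  have h1 : Tendsto (fun k : ℕ => r / (1 - α) * (1 - α ^ (k + 1)) - α ^ (k + 1) * dist c x) atTop
      (𝓝 (r / (1 - α) * (1 - 0) - 0 * dist c x)) :=
    ((hpow.const_sub 1).const_mul _).sub (hpow.mul_const _)
  obtain ⟨k, hk⟩ := (h1.eventually (lt_mem_nhds (a := dist y c) (by simpa using hy))).exists
  refine (mem_iff_ball_iterate_subset hr hα0 hα1 hσ himage k x).1 hx ?_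
  have h2 := dist_iterate hσ (k + 1) c x
  rw [Function.iterate_fixed hc] at h2
  rw [mem_ball]
  linarith [dist_triangle y c (σ^[k + 1] x)]

/-- The complement of `X` is covered by arbitrarily large balls in the complement. -/
theorem exists_large_ball_disjoint (hr : 0 < r) (hα0 : 0 < α) (hα1 : α < 1)
    (hσ : ∀ x y, dist (σ x) (σ y) = α * dist x y) (himage : σ '' X = erosion r X)
    {z : EuclideanSpace ℝ (Fin n)} (hz : z ∉ X) (M : ℝ) :
    ∃ y, ∃ ρ > M, dist z y < ρ ∧ Disjoint (ball y ρ) X := by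
  have hR : 0 < r / (1 - α) := div_pos hr (sub_pos.2 hα1)
  obtain ⟨k, hk⟩ := pow_unbounded_of_one_lt (M / (r / (1 - α)) + 1) ((one_lt_inv₀ hα0).2 hα1)
  have hpow : 0 < α ^ (k + 1) := pow_pos hα0 _
  rw [mem_iff_ball_iterate_subset hr hα0 hα1 hσ himage k, Set.not_subset] at hz
  obtain ⟨w, hw, hwX⟩ := hz
  obtain ⟨y, rfl⟩ := σ.surjective.iterate (k + 1) w
  -- Pulled back by `σ^[k + 1]`, the radius becomes R(α^(-(k+1)) - 1), which is unbounded in `k`. A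
  -- point of `X` within `ρ` of `y` would have `w` in its iterated ball, although `w` is outside
  -- `X`.
  set ρ := r / (1 - α) * (1 - α ^ (k + 1)) / α ^ (k + 1) with hρ
  have hρ' : r / (1 - α) * (1 - α ^ (k + 1)) = α ^ (k + 1) * ρ := by
    rw [hρ, mul_div_cancel₀ _ hpow.ne']
  refine ⟨y, ρ, ?_, ?_, ?_⟩
  · have h1 : M / (r / (1 - α)) + 1 < (α⁻¹) ^ (k + 1) :=
      hk.trans_le (pow_le_pow_right₀ ((one_lt_inv₀ hα0).2 hα1).le k.le_succ)
    have h2 : ρ = ((α⁻¹) ^ (k + 1) - 1) * (r / (1 - α)) := by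
      rw [hρ, inv_pow]; field_simp
    rw [gt_iff_lt, h2, ← div_lt_iff₀ hR]
    linarith
  · rw [mem_ball, dist_comm, dist_iterate hσ, hρ', mul_lt_mul_iff_right₀ hpow] at hw
    exact hw
  · rw [Set.disjoint_left]
    intro x hx hxX
    refine hwX ((mem_iff_ball_iterate_subset hr hα0 hα1 hσ himage k x).1 hxX ?_)
    rw [mem_ball, dist_iterate hσ, hρ', mul_lt_mul_iff_right₀ hpow, dist_comm]
    exact hx

end Similarity

/-! ### Convexity from large balls in the complement -/

/-- A closed set with an interior point whose complement is covered by arbitrarily large balls in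
the complement is convex. -/
theorem convex_of_large_balls {E : Type*} [NormedAddCommGroup E] [InnerProductSpace ℝ E]
    {X : Set E} (hcl : IsClosed X) {c : E} {R : ℝ} (hR : 0 < R) (hc : ball c R ⊆ X)
    (hlarge : ∀ z ∉ X, ∀ M : ℝ, ∃ y, ∃ ρ > M, dist z y < ρ ∧ Disjoint (ball y ρ) X) :
    Convex ℝ X := by
  intro x₁ hx₁ x₂ hx₂ a b ha hb hab
  by_contra hz
  -- Moving the bad point slightly towards `c` keeps it outside `X` and gives `c` a positive weight
  -- `ε` in the combination.
  have hev : ∀ᶠ t : ℝ in nhdsWithin 0 (Set.Ioi 0), c + (1 - t) • (a • x₁ + b • x₂ - c) ∈ Xᶜ := by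
    refine nhdsWithin_le_nhds ?_
    have hcont : Continuous fun t : ℝ => c + (1 - t) • (a • x₁ + b • x₂ - c) := by fun_prop
    exact hcont.continuousAt.eventually_mem (hcl.isOpen_compl.mem_nhds (by simpa using hz))
  obtain ⟨ε, hzε, hε0, hε1⟩ := (hev.and (Ioo_mem_nhdsGT zero_lt_one)).exists
  set z := c + (1 - ε) • (a • x₁ + b • x₂ - c) with hzdef
  -- `V` is the variance of `x₁`, `x₂`, `c` about their barycentre `z`. Their mean squared distance
  -- to `y` is `V + ‖z - y‖ ^ 2 < V + ρ ^ 2`, yet at least `ρ ^ 2 + 2 * ε * ρ * R`, since `c` is `R`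
  -- farther away; this fails for large `ρ`.
  set V := (1 - ε) * (a * ‖x₁ - z‖ ^ 2 + b * ‖x₂ - z‖ ^ 2) + ε * ‖c - z‖ ^ 2 with hV
  obtain ⟨y, ρ, hρ, hzy, hdisj⟩ := hlarge z hzε (max 0 (V / (2 * ε * R)))
  have hρ0 : 0 < ρ := (le_max_left _ _).trans_lt hρ
  have hρV : V < ρ * (2 * ε * R) := by
    rw [← div_lt_iff₀ (by positivity)]
    exact (le_max_right _ _).trans_lt hρ
  have hcy : ρ + R ≤ ‖c - y‖ := by
    rw [← dist_eq_norm, dist_comm]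
    exact (disjoint_ball_ball_iff hρ0 hR).1 (hdisj.mono_right hc)
  have hfar : ∀ x ∈ X, ρ ^ 2 ≤ ‖x - y‖ ^ 2 := fun x hx => by
    refine pow_le_pow_left₀ hρ0.le ?_ 2
    by_contra! hlt
    exact Set.disjoint_left.1 hdisj (by rwa [mem_ball, dist_eq_norm]) hx
  have hexp : ∀ x, ‖x - y‖ ^ 2 = ‖x - z‖ ^ 2 + 2 * inner ℝ (x - z) (z - y) + ‖z - y‖ ^ 2 :=
    fun x => by rw [← norm_add_sq_real, sub_add_sub_cancel]
  have hzero : (1 - ε) * (a * inner ℝ (x₁ - z) (z - y) + b * inner ℝ (x₂ - z) (z - y)) +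
      ε * inner ℝ (c - z) (z - y) = 0 := by
    have hb' : b = 1 - a := by linarith
    have : (1 - ε) • (a • (x₁ - z) + b • (x₂ - z)) + ε • (c - z) = 0 := by
      rw [hzdef, hb']; module
    have h := congrArg (fun w => inner ℝ w (z - y)) this
    simpa [inner_add_left, real_inner_smul_left, mul_add] using h
  have h1 := hfar x₁ hx₁
  have h2 := hfar x₂ hx₂
  have h3 : (ρ + R) ^ 2 ≤ ‖c - y‖ ^ 2 := pow_le_pow_left₀ (by positivity) hcy 2
  have h4 : ‖z - y‖ ^ 2 < ρ ^ 2 := by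
    rw [← dist_eq_norm]
    exact pow_lt_pow_left₀ hzy dist_nonneg two_ne_zero
  have h12 : ρ ^ 2 ≤ a * ‖x₁ - y‖ ^ 2 + b * ‖x₂ - y‖ ^ 2 := by
    calc ρ ^ 2 = a * ρ ^ 2 + b * ρ ^ 2 := by rw [← add_mul, hab, one_mul]
      _ ≤ _ := by gcongr
  have h5 : (1 - ε) * ρ ^ 2 + ε * (ρ + R) ^ 2 ≤
      (1 - ε) * (a * ‖x₁ - y‖ ^ 2 + b * ‖x₂ - y‖ ^ 2) + ε * ‖c - y‖ ^ 2 := by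
    have : 0 ≤ 1 - ε := by linarith
    gcongr
  have h6 : (1 - ε) * (a * ‖x₁ - y‖ ^ 2 + b * ‖x₂ - y‖ ^ 2) + ε * ‖c - y‖ ^ 2 =
      V + ‖z - y‖ ^ 2 := by
    rw [hexp x₁, hexp x₂, hexp c, hV]
    linear_combination 2 * hzero + (1 - ε) * ‖z - y‖ ^ 2 * hab
  have h7 : 0 < ε * R ^ 2 := by positivity
  linarith

/-! ### Recurrence of isometries and the linear part of a similarity -/

open Filter Topology in
/-- Orbits of linear isometries are recurrent in proper spaces. -/
theorem exists_iterate_norm_sub_lt {E : Type*} [NormedAddCommGroup E] [InnerProductSpace ℝ E]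
    [ProperSpace E] (A : E ≃ₗᵢ[ℝ] E) (u : E) {ε : ℝ} (hε : 0 < ε) :
    ∃ k, k ≠ 0 ∧ ‖A^[k] u - u‖ < ε := by
  have hnorm : ∀ (k : ℕ) (w : E), ‖A^[k] w‖ = ‖w‖ := fun k w => by
    induction k with
    | zero => rfl
    | succ k ih => rw [Function.iterate_succ_apply', A.norm_map, ih]
  have hsub : ∀ (k : ℕ) (v w : E), A^[k] v - A^[k] w = A^[k] (v - w) := fun k v w => by
    induction k with
    | zero => rfl
    | succ k ih => simp only [Function.iterate_succ_apply', ← ih, map_sub]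
  obtain ⟨a, -, φ, hφ, hlim⟩ := tendsto_subseq_of_bounded (x := fun k => A^[k] u)
    (isBounded_closedBall (x := (0 : E)) (r := ‖u‖)) (fun k => by simp [hnorm])
  obtain ⟨N, hN⟩ := Metric.cauchySeq_iff.1 hlim.cauchySeq ε hε
  have hlt : φ N < φ (N + 1) := hφ N.lt_succ_self
  refine ⟨φ (N + 1) - φ N, by omega, ?_⟩
  have h := hN (N + 1) N.le_succ N le_rfl
  simp only [Function.comp_apply, dist_eq_norm] at h
  rwa [← Nat.add_sub_of_le hlt.le, Function.iterate_add_apply, hsub, hnorm] at h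

/-- A similarity with fixed point `c` is a linear isometry about `c` followed by scaling. -/
theorem exists_linearIsometryEquiv {E : Type*} [NormedAddCommGroup E] [NormedSpace ℝ E]
    {α : ℝ} (hα0 : 0 < α) {σ : E ≃ E} (hσ : ∀ x y, dist (σ x) (σ y) = α * dist x y) {c : E}
    (hc : σ c = c) : ∃ A : E ≃ₗᵢ[ℝ] E, ∀ x, σ x = c + α • A (x - c) := by
  let e : E ≃ E :=
    { toFun := fun x => α⁻¹ • (σ (x + c) - c)
      invFun := fun x => σ.symm (c + α • x) - c
      left_inv := fun x => by simp [smul_smul, mul_inv_cancel₀ hα0.ne']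
      right_inv := fun x => by simp [smul_smul, inv_mul_cancel₀ hα0.ne'] }
  let f : E ≃ᵢ E := ⟨e, Isometry.of_dist_eq fun x y => by
    change dist (α⁻¹ • (σ (x + c) - c)) (α⁻¹ • (σ (y + c) - c)) = _
    rw [dist_smul₀, dist_sub_right, hσ, dist_add_right, norm_inv, Real.norm_of_nonneg hα0.le,
      inv_mul_cancel_left₀ hα0.ne']⟩
  have hf : ∀ x, f x = α⁻¹ • (σ (x + c) - c) := fun _ => rfl
  -- Mazur–Ulam: a surjective isometry fixing 0 is linear.
  refine ⟨f.toRealLinearIsometryEquivOfMapZero (by simp [hf, hc]), fun x => ?_⟩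
  rw [IsometryEquiv.coe_toRealLinearIsometryEquivOfMapZero, hf, smul_inv_smul₀ hα0.ne']
  simp

/-! ### The ball about the fixed point is inscribed -/

section Inscribed

variable {n : ℕ} {X : Set (EuclideanSpace ℝ (Fin n))} {r α : ℝ}
  {σ : EuclideanSpace ℝ (Fin n) ≃ EuclideanSpace ℝ (Fin n)} {c : EuclideanSpace ℝ (Fin n)}
  {A : EuclideanSpace ℝ (Fin n) ≃ₗᵢ[ℝ] EuclideanSpace ℝ (Fin n)}

/-- A distance above `r` would persist for points near `x`, placing them all in `X` and making `x`
interior. -/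
theorem infDist_compl_eq_of_mem_frontier (hr : 0 < r)
    (hσ : Continuous σ) (himage : σ '' X = erosion r X) (hcl : IsClosed X)
    {x : EuclideanSpace ℝ (Fin n)} (hx : x ∈ frontier X) : infDist (σ x) Xᶜ = r := by
  have hne : Xᶜ.Nonempty := by
    rw [Set.nonempty_compl]
    rintro rfl
    simp at hx
  refine le_antisymm ?_ ?_
  · by_contra! hlt
    refine hx.2 (mem_interior_iff_mem_nhds.2 ?_)
    have hcont : Continuous fun y => infDist (σ y) Xᶜ := (continuous_infDist_pt _).comp hσ
    filter_upwards [hcont.continuousAt.eventually (lt_mem_nhds hlt)] with y hy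
    exact (mem_iff_ball_subset hr himage y).2
      ((ball_subset_ball hy.le).trans ball_infDist_compl_subset)
  · refine (le_infDist hne).2 fun y hy => ?_
    by_contra! hlt
    exact hy ((mem_iff_ball_subset hr himage x).1 (hcl.frontier_subset hx)
      (by rwa [mem_ball, dist_comm]))

/-- The similarity `σ` transports regular supporting hyperplanes, and scales by `α` the amount by
which their distance from the centre exceeds `r / (1 - α)`. -/
theorem exists_regular_image (hr : 0 < r) (hα0 : 0 < α) (hα1 : α < 1)
    (hA : ∀ x, σ x = c + α • A (x - c)) (himage : σ '' X = erosion r X) (hcl : IsClosed X)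
    (hconv : Convex ℝ X) {x u : EuclideanSpace ℝ (Fin n)} (hx : x ∈ frontier X)
    (hu : ∀ w, IsUnitNormal X x w ↔ w = u) :
    ∃ q ∈ frontier X, (∀ w, IsUnitNormal X q w ↔ w = A u) ∧
      inner ℝ (A u) (q - c) - r / (1 - α) = α * (inner ℝ u (x - c) - r / (1 - α)) := by
  have hcont : Continuous σ := by
    rw [show (σ : _ → _) = _ from funext hA]
    fun_prop
  have hinf := infDist_compl_eq_of_mem_frontier hr hcont himage hcl hx
  have hne : Xᶜ.Nonempty := by
    rw [Set.nonempty_compl]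
    rintro rfl
    simp at hx
  obtain ⟨v, hq, hv⟩ := exists_touching_point hcl hconv hne hr hinf
  have hvn := (hv v).2 rfl
  have hvv : inner ℝ v v = (1 : ℝ) := by rw [real_inner_self_eq_norm_sq, hvn.1]; norm_num
  -- The supporting half-space at the touching point, moved inwards by `r`, contains `σ '' X` and
  -- has `σ x` on its boundary; pulled back by `σ` it supports `X` at `x`, where the normal is
  -- unique.
  have hAv : A.symm v = u := by
    refine (hu _).1 ⟨by rw [A.symm.norm_map, hvn.1], fun y hy => ?_⟩
    have h := inner_add_le_of_ball_subset hr hvn.1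
      fun z hz => hvn.2 z ((mem_iff_ball_subset hr himage y).1 hy hz)
    have hinner : ∀ z, inner ℝ v (A z) = inner ℝ (A.symm v) z := fun z => by
      rw [← A.inner_map_map (A.symm v), A.apply_symm_apply]
    rw [hA, hA] at h
    simp only [inner_add_right, inner_smul_right, hinner, inner_sub_right, hvv] at h
    have : α * inner ℝ (A.symm v) y ≤ α * inner ℝ (A.symm v) x := by linarith
    exact le_of_mul_le_mul_left this hα0
  obtain rfl : v = A u := by rw [← hAv, A.apply_symm_apply]
  refine ⟨_, hq, hv, ?_⟩
  have h1 : σ x + r • A u - c = α • A (x - c) + r • A u := by rw [hA]; abel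
  have h1α : 1 - α ≠ 0 := (sub_pos.2 hα1).ne'
  rw [h1, inner_add_right, inner_smul_right, inner_smul_right, hvv, A.inner_map_map]
  field_simp
  ring

theorem exists_regular_iterate (hr : 0 < r) (hα0 : 0 < α) (hα1 : α < 1)
    (hA : ∀ x, σ x = c + α • A (x - c)) (himage : σ '' X = erosion r X) (hcl : IsClosed X)
    (hconv : Convex ℝ X) {x u : EuclideanSpace ℝ (Fin n)} (hx : x ∈ frontier X)
    (hu : ∀ w, IsUnitNormal X x w ↔ w = u) (k : ℕ) :
    ∃ q ∈ frontier X, (∀ w, IsUnitNormal X q w ↔ w = A^[k] u) ∧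
      inner ℝ (A^[k] u) (q - c) - r / (1 - α) = α ^ k * (inner ℝ u (x - c) - r / (1 - α)) := by
  induction k with
  | zero => exact ⟨x, hx, hu, by simp⟩
  | succ k ih =>
    obtain ⟨q, hq, hqn, hqd⟩ := ih
    obtain ⟨q', hq', hqn', hqd'⟩ := exists_regular_image hr hα0 hα1 hA himage hcl hconv hq hqn
    simp only [Function.iterate_succ_apply']
    exact ⟨q', hq', hqn', by rw [hqd', hqd]; ring⟩

/-- A return of `A^[k] u` close to `u` keeps the offset of `x` from `c` in that direction above `r /
(1 - α) + α * d`, while `X` reaches only `r / (1 - α) + α ^ k * d` there. -/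
theorem inner_le_of_regular (hr : 0 < r) (hα0 : 0 < α) (hα1 : α < 1)
    (hA : ∀ x, σ x = c + α • A (x - c)) (himage : σ '' X = erosion r X) (hcl : IsClosed X)
    (hconv : Convex ℝ X) {x u : EuclideanSpace ℝ (Fin n)} (hx : x ∈ frontier X)
    (hu : ∀ w, IsUnitNormal X x w ↔ w = u) : inner ℝ u (x - c) ≤ r / (1 - α) := by
  by_contra! hlt
  set d := inner ℝ u (x - c) - r / (1 - α) with hd
  have hd0 : 0 < d := sub_pos.2 hlt
  have h1α : 0 < 1 - α := sub_pos.2 hα1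
  have hpos : 0 < ‖x - c‖ + 1 := by positivity
  obtain ⟨k, hk0, hk⟩ := exists_iterate_norm_sub_lt A u
    (div_pos (mul_pos hd0 h1α) hpos)
  obtain ⟨q, -, hqn, hqd⟩ :=
    exists_regular_iterate hr hα0 hα1 hA himage hcl hconv hx hu k
  rw [← hd] at hqd
  have h1 := ((hqn _).2 rfl).2 x (hcl.frontier_subset hx)
  have h2 : -(‖A^[k] u - u‖ * ‖x - c‖) ≤ inner ℝ (A^[k] u) (x - c) - inner ℝ u (x - c) := by
    rw [← inner_sub_left]
    exact neg_le_of_abs_le (abs_real_inner_le_norm _ _)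
  have h3 : α ^ k * d ≤ α * d := by
    gcongr
    exact pow_le_of_le_one hα0.le hα1.le hk0
  rw [lt_div_iff₀ hpos] at hk
  rw [inner_sub_right] at hqd h2
  have h4 := norm_nonneg (A^[k] u - u)
  linarith

theorem isConvexBody_and_exists_isInscribedBall (hne : X.Nonempty) (hr : 0 < r) (hα0 : 0 < α)
    (hα1 : α < 1) (hσ : ∀ x y, dist (σ x) (σ y) = α * dist x y)
    (himage : σ '' X = erosion r X) :
    IsConvexBody X ∧ ∃ c, IsInscribedBall X c (r / (1 - α)) := by
  have hcontr : ContractingWith α.toNNReal σ := by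
    refine ⟨by simpa using hα1, LipschitzWith.of_dist_le_mul fun x y => ?_⟩
    rw [hσ, Real.coe_toNNReal α hα0.le]
  obtain ⟨c, hc⟩ : ∃ c, σ c = c := ⟨_, hcontr.fixedPoint_isFixedPt⟩
  have hR : 0 < r / (1 - α) := div_pos hr (sub_pos.2 hα1)
  have hcl := isClosed_of_image_eq_erosion hr hσ himage
  have hball := closedBall_subset_of_image_eq_erosion hr hα0 hα1 hσ himage hne hc
  have hconv := convex_of_large_balls hcl hR (ball_subset_closedBall.trans hball)
    fun z hz M => exists_large_ball_disjoint hr hα0 hα1 hσ himage hz M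
  obtain ⟨A, hA⟩ := exists_linearIsometryEquiv hα0 hσ hc
  refine ⟨⟨hcl, hconv⟩, c, hball, fun P hP => ?_⟩
  obtain ⟨x, hx, u, hu, rfl⟩ := isRegularSupportingHyperplane_iff.1 hP
  have hun := (hu u).2 rfl
  have hle := inner_le_of_regular hr hα0 hα1 hA himage hcl hconv hx hu
  have hge := inner_add_le_of_ball_subset hR hun.1
    fun y hy => hun.2 y (hball (ball_subset_closedBall hy))
  rw [inner_sub_right] at hle
  refine ⟨c + (r / (1 - α)) • u, ?_, ?_⟩
  · rw [mem_closedBall, dist_self_add_left, norm_smul, hun.1, mul_one, Real.norm_of_nonneg hR.le]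
  · rw [Set.mem_ofPred_eq, inner_add_right, inner_smul_right, real_inner_self_eq_norm_sq, hun.1]
    linarith

end Inscribed

end Resilient

theorem theorem2 (n : ℕ) (X : Set (EuclideanSpace ℝ (Fin n))) (hX : X.Nonempty)
    (r : ℝ) (hr : 0 < r) :
    (∃ σ : EuclideanSpace ℝ (Fin n) ≃ᵈ EuclideanSpace ℝ (Fin n),
        Resilient.IsDistanceDecreasing σ ∧ σ '' X = Resilient.erosion r X) ↔
      (Resilient.IsConvexBody X ∧
        ∃ (c : EuclideanSpace ℝ (Fin n)) (R : ℝ), r < R ∧ Resilient.IsInscribedBall X c R) := by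
  constructor
  · rintro ⟨σ, ⟨α, hα0, hα1, hσ⟩, himage⟩
    obtain ⟨hbody, c, hc⟩ := Resilient.isConvexBody_and_exists_isInscribedBall (σ := σ.toEquiv)
      hX hr hα0 hα1 hσ himage
    refine ⟨hbody, c, _, ?_, hc⟩
    rw [lt_div_iff₀ (sub_pos.2 hα1)]
    nlinarith
  · rintro ⟨hbody, c, R, hrR, hc⟩
    exact Resilient.exists_similarity_of_isInscribedBall hr hbody hrR hc
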